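/- Let $M\ge 0$ and $N\ge 1$ be integers, $\beta>0$, and $\lambda_S,\lambda_R,\mu\ge 0$. Let $\Gamma_{M+N}(\vec v,\vec w)=\prod_{i=1}^M\gamma(v_i)\prod_{j=1}^N\gamma(w_j)$ with $\gamma(x)=\sqrt{\beta/2\pi}\,e^{-\beta x^2/2}$, and let $\|\cdot\|_2$ be the norm of the real space $L^2(\mathbb R^{M+N},\Gamma_{M+N}\,d\vec v\,d\vec w)$. For two distinct particles $a,b$ among the $M$ system particles (velocities $v_1,\dots,v_M$) and the $N$ reservoir particles (velocities $w_1,\dots,w_N$), let $R_{a,b}h$ be the average over $\theta\in[0,2\pi]$, with respect to $d\theta/2\pi$, of the function $h$ evaluated at the configuration in which the velocities $x_a,x_b$ of $a,b$ are replaced by $$x_a\cos\theta+x_b\sin\theta,\qquad -x_a\sin\theta+x_b\cos\theta .$$ Write $R^S_{i,j}$, $R^R_{i,j}$, $R^I_{i,j}$ when $a,b$ are the system particles $i,j$; the reservoir particles $i,j$; the system particle $i$ and the reservoir particle $j$, respectively. For $1\le i\le M$ let $$T_ih(\vec v,\vec w)=\int_{\mathbb R}\gamma(u)\,\frac1{2\pi}\int_0^{2\pi}h(v_1,\dots,v_i\cos\theta+u\sin\theta,\dots,v_M,\vec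 w)\,d\theta\,du .$$ On $L^2(\Gamma_{M+N})$ consider the bounded operators $$\mathcal L_S=\frac{\lambda_S}{M-1}\sum_{1\le i<j\le M}(R^S_{i,j}-I),\qquad \mathcal L_R=\frac{\lambda_R}{N-1}\sum_{1\le i<j\le N}(R^R_{i,j}-I),$$ $$\mathcal L_I=\frac{\mu}{N}\sum_{i=1}^M\sum_{j=1}^N(R^I_{i,j}-I),\qquad \mathcal L_T=\mu\sum_{i=1}^M(T_i-I)$$ (empty sums being $0$), the generator $\mathcal L=\mathcal L_S+\mathcal L_R+\mathcal L_I$ of the system coupled to the finite reservoir, and the generator $\overline{\mathcal L}=\mathcal L_S+\mathcal L_R+\mathcal L_T$ of the system coupled to the Maxwellian thermostat, both acting on densities relative to $\Gamma_{M+N}$. Let $h_0$ be a real function of $\vec v\in\mathbb R^M$ only which, regarded as a function of $(\vec v,\vec w)$, belongs to $L^2(\Gamma_{M+N})$; thus the initial density is $f_0(\vec v,\vec w)=h_0(\vec v)\,\Gamma_{M+N}(\vec v,\vec w)$, with the reservoir in equilibrium. Then for every $t>0$ $$\bigl\|e^{\overline{\mathcal L}t}h_0-e^{\mathcal Lt}h_0\bigr\|_2\le\frac{M}{\sqrt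 N}\bigl(1-e^{-\mu t/2}\bigr)\,\|h_0-1\|_2 .$$ -/

import Mathlib

open MeasureTheory ProbabilityTheory
open scoped NNReal ENNReal

noncomputable section

namespace KacReservoir

/-! ### Averaging operators on `L²` -/

section AverageOp

variable {X Θ : Type*} [MeasurableSpace X] [MeasurableSpace Θ]

/-- `(average ν φ f)(x) = ∫ f(φ(x,θ)) dν(θ)`. -/
def average (ν : Measure Θ) (φ : X × Θ → X) (f : X → ℝ) (x : X) : ℝ :=
  ∫ θ, f (φ (x, θ)) ∂ν

variable {m : Measure X} {ν : Measure Θ} [IsFiniteMeasure m] [IsProbabilityMeasure ν]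
  {φ : X × Θ → X}

theorem aestronglyMeasurable_average (hφ : MeasurePreserving φ (m.prod ν) m) {f : X → ℝ}
    (hf : MemLp f 2 m) : AEStronglyMeasurable (average ν φ f) m :=
  (hf.comp_measurePreserving hφ).aestronglyMeasurable.integral_prod_right'

theorem eLpNorm_average_le (hφ : MeasurePreserving φ (m.prod ν) m) {f : X → ℝ}
    (hf : MemLp f 2 m) : eLpNorm (average ν φ f) 2 m ≤ eLpNorm f 2 m := by
  have hg : MemLp (f ∘ φ) 2 (m.prod ν) := hf.comp_measurePreserving hφ
  rw [← eLpNorm_comp_measurePreserving hf.aestronglyMeasurable hφ]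
  simp only [eLpNorm_eq_lintegral_rpow_enorm_toReal (p := 2) (by norm_num) (by norm_num)]
  refine ENNReal.rpow_le_rpow ?_ (by norm_num)
  rw [lintegral_prod _ (by
    simpa using (hg.aestronglyMeasurable.enorm.pow_const (2 : ℝ)))]
  refine lintegral_mono_ae ?_
  filter_upwards [hg.aestronglyMeasurable.prodMk_left] with x hx
  have h1 : ‖average ν φ f x‖ₑ ≤ eLpNorm (fun θ => (f ∘ φ) (x, θ)) 1 ν := by
    rw [eLpNorm_one_eq_lintegral_enorm]
    exact enorm_integral_le_lintegral_enorm _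
  have h2 := h1.trans (eLpNorm_le_eLpNorm_of_exponent_le (q := 2) (by norm_num) hx)
  rw [eLpNorm_eq_lintegral_rpow_enorm_toReal (p := 2) (by norm_num) (by norm_num)] at h2
  refine (ENNReal.rpow_le_rpow h2 (by norm_num : (0 : ℝ) ≤ (2 : ℝ≥0∞).toReal)).trans ?_
  rw [← ENNReal.rpow_mul]
  simp

theorem memLp_average (hφ : MeasurePreserving φ (m.prod ν) m) {f : X → ℝ}
    (hf : MemLp f 2 m) : MemLp (average ν φ f) 2 m :=
  ⟨aestronglyMeasurable_average hφ hf, (eLpNorm_average_le hφ hf).trans_lt hf.2⟩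

theorem average_congr (hφ : MeasurePreserving φ (m.prod ν) m) {f g : X → ℝ}
    (h : f =ᵐ[m] g) : average ν φ f =ᵐ[m] average ν φ g := by
  have := hφ.quasiMeasurePreserving.ae_eq_comp h
  filter_upwards [Measure.ae_ae_of_ae_prod this] with x hx
  exact integral_congr_ae hx

theorem ae_integrable_slice (hφ : MeasurePreserving φ (m.prod ν) m) {f : X → ℝ}
    (hf : MemLp f 2 m) : ∀ᵐ x ∂m, Integrable (fun θ => f (φ (x, θ))) ν :=
  ((hf.comp_measurePreserving hφ).integrable (by norm_num)).prod_right_ae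

/-- The bounded operator on `L²(m)` induced by `average ν φ`, where `φ` carries the product of `m`
and the probability measure `ν` to `m`. -/
def averageOp (hφ : MeasurePreserving φ (m.prod ν) m) : Lp ℝ 2 m →L[ℝ] Lp ℝ 2 m :=
  LinearMap.mkContinuous
    { toFun := fun f => (memLp_average hφ (Lp.memLp f)).toLp (average ν φ f)
      map_add' := by
        intro f g
        rw [← MemLp.toLp_add]
        refine (MemLp.toLp_eq_toLp_iff _ _).2 ?_
        filter_upwards [average_congr hφ (Lp.coeFn_add f g),
          ae_integrable_slice hφ (Lp.memLp f), ae_integrable_slice hφ (Lp.memLp g)] with x h hf hg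
        rw [h]
        exact integral_add hf hg
      map_smul' := by
        intro c f
        rw [RingHom.id_apply, ← MemLp.toLp_const_smul]
        refine (MemLp.toLp_eq_toLp_iff _ _).2 ?_
        filter_upwards [average_congr hφ (Lp.coeFn_smul c f)] with x h
        rw [h]
        exact integral_smul c _ }
    1 (by
      intro f
      rw [one_mul]
      change ‖(memLp_average hφ (Lp.memLp f)).toLp (average ν φ f)‖ ≤ ‖f‖
      rw [Lp.norm_toLp, Lp.norm_def]
      exact ENNReal.toReal_mono (Lp.eLpNorm_ne_top f) (eLpNorm_average_le hφ (Lp.memLp f)))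

end AverageOp

/-! ### Maxwellian measures and collisions -/

/-- The law of one Maxwellian velocity at inverse temperature `β`: for `β > 0` it has density
`√(β/2π) exp(-β w²/2)`. -/
def maxwell (β : ℝ≥0) : Measure ℝ := gaussianReal 0 β⁻¹

instance (β : ℝ≥0) : IsProbabilityMeasure (maxwell β) :=
  inferInstanceAs (IsProbabilityMeasure (gaussianReal 0 β⁻¹))

/-- Velocities `(v, w)` of the `M` system particles (left summand) and of the `N` reservoir
particles (right summand). -/
abbrev Velocities (M N : ℕ) : Type := Fin M ⊕ Fin N → ℝ

/-- The Maxwellian measure `Γ_{M+N}(v,w) dv dw` at inverse temperature `β`. -/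
def maxwellian (β : ℝ≥0) (M N : ℕ) : Measure (Velocities M N) :=
  Measure.pi fun _ => maxwell β

instance (β : ℝ≥0) (M N : ℕ) : IsProbabilityMeasure (maxwellian β M N) :=
  inferInstanceAs (IsProbabilityMeasure (Measure.pi fun _ => maxwell β))

/-- The uniform probability measure on the angles `(0, 2π]`. -/
def uniformAngle : Measure ℝ := cond volume (Set.Ioc 0 (2 * Real.pi))

instance : IsProbabilityMeasure uniformAngle :=
  cond_isProbabilityMeasure_of_finite (by simp [Real.pi_pos]) measure_Ioc_lt_top.ne

section Maps

variable {ι : Type*} [DecidableEq ι]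

/-- The velocities after a collision of the particles `a` and `b` with angle `θ`, as a function of
the pair (velocities, angle). -/
def collisionMap (a b : ι) (p : (ι → ℝ) × ℝ) : ι → ℝ := fun k =>
  if k = a then p.1 a * Real.cos p.2 + p.1 b * Real.sin p.2
  else if k = b then -p.1 a * Real.sin p.2 + p.1 b * Real.cos p.2
  else p.1 k

/-- The velocities after particle `a` has collided, with angle `θ`, with an external particle of
velocity `w`, as a function of (velocities, (`w`, `θ`)). -/
def thermostatMap (a : ι) (p : (ι → ℝ) × (ℝ × ℝ)) : ι → ℝ :=
  Function.update p.1 a (p.1 a * Real.cos p.2.2 + p.2.1 * Real.sin p.2.2)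

theorem measurable_collisionMap (a b : ι) : Measurable (collisionMap a b) := by
  refine measurable_pi_lambda _ fun k => ?_
  unfold collisionMap
  split_ifs <;> fun_prop

theorem measurable_thermostatMap (a : ι) : Measurable (thermostatMap a) := by
  refine measurable_pi_lambda _ fun k => ?_
  by_cases h : k = a
  · subst h
    simp only [thermostatMap, Function.update_self]
    fun_prop
  · simp only [thermostatMap, Function.update_of_ne h]
    fun_prop

variable [Fintype ι]

theorem charFunDual_maxwell (β : ℝ≥0) (L : StrongDual ℝ ℝ) :
    charFunDual (maxwell β) L = Complex.exp (-((β⁻¹ : ℝ≥0) : ℂ) / 2 * ((L 1 : ℝ) : ℂ) ^ 2) := by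
  have hL : ∀ x, L x = x * L 1 := fun x => by
    rw [← smul_eq_mul, ← map_smul, smul_eq_mul, mul_one]
  have := charFun_gaussianReal (μ := 0) (v := β⁻¹) (L 1)
  rw [charFun_apply_real] at this
  rw [charFunDual_apply, maxwell]
  have h2 : ∀ x : ℝ, Complex.exp ((L x : ℝ) * Complex.I) =
      Complex.exp ((L 1 : ℝ) * (x : ℂ) * Complex.I) := fun x => by
    rw [hL x, Complex.ofReal_mul, mul_comm ((x : ℝ) : ℂ)]
  rw [integral_congr_ae (Filter.Eventually.of_forall h2), this]
  congr 1
  push_cast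
  ring

theorem charFunDual_pi_maxwell (β : ℝ≥0) (L : StrongDual ℝ (ι → ℝ)) :
    charFunDual (Measure.pi fun _ : ι => maxwell β) L =
      Complex.exp (-((β⁻¹ : ℝ≥0) : ℂ) / 2 * ((∑ k, (L (Pi.single k 1)) ^ 2 : ℝ) : ℂ)) := by
  rw [charFunDual_pi]
  simp_rw [charFunDual_maxwell]
  rw [← Complex.exp_sum]
  push_cast
  rw [Finset.mul_sum]
  simp

theorem measurePreserving_collision (β : ℝ≥0) {a b : ι} (hab : a ≠ b) (θ : ℝ) :
    MeasurePreserving (fun x => collisionMap a b (x, θ))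
      (Measure.pi fun _ : ι => maxwell β) (Measure.pi fun _ : ι => maxwell β) := by
  let A : (ι → ℝ) →L[ℝ] (ι → ℝ) := LinearMap.toContinuousLinearMap
    { toFun := fun x => collisionMap a b (x, θ)
      map_add' := by
        intro x y; ext k; simp only [collisionMap, Pi.add_apply]; split_ifs <;> ring
      map_smul' := by
        intro c x; ext k
        simp only [collisionMap, Pi.smul_apply, smul_eq_mul, RingHom.id_apply]
        split_ifs <;> ring }
  have hA : (fun x => collisionMap a b (x, θ)) = A := rfl
  refine ⟨by rw [hA]; exact A.continuous.measurable, ?_⟩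
  rw [hA]
  refine Measure.ext_of_charFunDual (funext fun L => ?_)
  rw [charFunDual_map, charFunDual_pi_maxwell, charFunDual_pi_maxwell]
  congr 3
  have ha : A (Pi.single a 1) = Real.cos θ • Pi.single a 1 - Real.sin θ • Pi.single b 1 := by
    ext k
    change collisionMap a b (Pi.single a 1, θ) k = _
    by_cases h1 : k = a
    · subst h1; simp [collisionMap, hab, hab.symm]
    · by_cases h2 : k = b
      · subst h2; simp [collisionMap, h1]
      · simp [collisionMap, h1, h2]
  have hb : A (Pi.single b 1) = Real.sin θ • Pi.single a 1 + Real.cos θ • Pi.single b 1 := by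
    ext k
    change collisionMap a b (Pi.single b 1, θ) k = _
    by_cases h1 : k = a
    · subst h1; simp [collisionMap, hab]
    · by_cases h2 : k = b
      · subst h2; simp [collisionMap, h1, hab]
      · simp [collisionMap, h1, h2]
  have hk : ∀ k, k ≠ a → k ≠ b → A (Pi.single k 1) = Pi.single k 1 := by
    intro c hca hcb
    ext k
    change collisionMap a b (Pi.single c 1, θ) k = _
    by_cases h1 : k = a
    · subst h1; simp [collisionMap, hca.symm, hcb.symm]
    · by_cases h2 : k = b
      · subst h2; simp [collisionMap, h1, hca.symm, hcb.symm]
      · simp [collisionMap, h1, h2]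
  have hbm : b ∈ Finset.univ.erase a := by simp [hab.symm]
  rw [← Finset.add_sum_erase _ _ (Finset.mem_univ a), ← Finset.add_sum_erase _ _ hbm,
    ← Finset.add_sum_erase _ (fun k => L (Pi.single k 1) ^ 2) (Finset.mem_univ a),
    ← Finset.add_sum_erase _ (fun k => L (Pi.single k 1) ^ 2) hbm, ← add_assoc, ← add_assoc]
  congr 1
  · simp only [ContinuousLinearMap.comp_apply, ha, hb, map_sub, map_add, map_smul, smul_eq_mul]
    linear_combination (L (Pi.single a 1) ^ 2 + L (Pi.single b 1) ^ 2) * Real.sin_sq_add_cos_sq θ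
  · refine Finset.sum_congr rfl fun k hk' => ?_
    simp only [Finset.mem_erase, Finset.mem_univ, and_true] at hk'
    simp only [ContinuousLinearMap.comp_apply, hk k hk'.2 hk'.1]

theorem measurePreserving_thermostat (β : ℝ≥0) (a : ι) (θ : ℝ) :
    MeasurePreserving (fun p : (ι → ℝ) × ℝ => thermostatMap a (p.1, (p.2, θ)))
      ((Measure.pi fun _ : ι => maxwell β).prod (maxwell β))
      (Measure.pi fun _ : ι => maxwell β) := by
  let A : ((ι → ℝ) × ℝ) →L[ℝ] (ι → ℝ) := LinearMap.toContinuousLinearMap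
    { toFun := fun p => thermostatMap a (p.1, (p.2, θ))
      map_add' := by
        intro x y; ext k
        by_cases h : k = a
        · subst h; simp [thermostatMap]; ring
        · simp [thermostatMap, h]
      map_smul' := by
        intro c x; ext k
        by_cases h : k = a
        · subst h; simp [thermostatMap]; ring
        · simp [thermostatMap, h] }
  have hA : (fun p : (ι → ℝ) × ℝ => thermostatMap a (p.1, (p.2, θ))) = A := rfl
  refine ⟨by rw [hA]; exact A.continuous.measurable, ?_⟩
  rw [hA]
  refine Measure.ext_of_charFunDual (funext fun L => ?_)
  rw [charFunDual_map, charFunDual_prod, charFunDual_pi_maxwell, charFunDual_pi_maxwell,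
    charFunDual_maxwell, ← Complex.exp_add, ← mul_add]
  congr 2
  norm_cast
  have ha : A (Pi.single a 1, 0) = Real.cos θ • Pi.single a 1 := by
    ext k
    change thermostatMap a (Pi.single a 1, ((0 : ℝ), θ)) k = _
    by_cases h : k = a
    · subst h; simp [thermostatMap]
    · simp [thermostatMap, h]
  have hw : A (0, 1) = Real.sin θ • Pi.single a 1 := by
    ext k
    change thermostatMap a ((0 : ι → ℝ), ((1 : ℝ), θ)) k = _
    by_cases h : k = a
    · subst h; simp [thermostatMap]
    · simp [thermostatMap, h]
  have hk : ∀ k, k ≠ a → A (Pi.single k 1, 0) = Pi.single k 1 := by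
    intro c hc
    ext k
    change thermostatMap a (Pi.single c 1, ((0 : ℝ), θ)) k = _
    by_cases h : k = a
    · subst h; simp [thermostatMap, hc.symm]
    · simp [thermostatMap, h]
  rw [← Finset.add_sum_erase _ _ (Finset.mem_univ a),
    ← Finset.add_sum_erase _ (fun k => L (Pi.single k 1) ^ 2) (Finset.mem_univ a), add_right_comm]
  congr 1
  · simp only [ContinuousLinearMap.comp_apply, ContinuousLinearMap.inl_apply,
      ContinuousLinearMap.inr_apply, ha, hw, map_smul, smul_eq_mul]
    linear_combination (L (Pi.single a 1) ^ 2) * Real.sin_sq_add_cos_sq θ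
  · refine Finset.sum_congr rfl fun k hk' => ?_
    simp only [Finset.mem_erase, Finset.mem_univ, and_true] at hk'
    simp only [ContinuousLinearMap.comp_apply, ContinuousLinearMap.inl_apply, hk k hk']

end Maps

theorem measurePreserving_of_slices {X Y Θ : Type*} [MeasurableSpace X] [MeasurableSpace Y]
    [MeasurableSpace Θ] {m : Measure X} {m' : Measure Y} {ν : Measure Θ} [SFinite m]
    [IsProbabilityMeasure ν] {φ : X × Θ → Y} (hφ : Measurable φ)
    (h : ∀ θ, MeasurePreserving (fun x => φ (x, θ)) m m') :
    MeasurePreserving φ (m.prod ν) m' := by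
  refine ⟨hφ, Measure.ext fun s hs => ?_⟩
  rw [Measure.map_apply hφ hs, Measure.prod_apply_symm (hφ hs)]
  have : ∀ θ, m ((fun x => (x, θ)) ⁻¹' (φ ⁻¹' s)) = m' s := fun θ =>
    (h θ).measure_preimage hs.nullMeasurableSet
  simp [this]

theorem measurePreserving_collisionMap (β : ℝ≥0) {M N : ℕ} {a b : Fin M ⊕ Fin N} (hab : a ≠ b) :
    MeasurePreserving (collisionMap a b) ((maxwellian β M N).prod uniformAngle)
      (maxwellian β M N) :=
  measurePreserving_of_slices (measurable_collisionMap a b)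
    fun θ => measurePreserving_collision β hab θ

theorem measurePreserving_thermostatMap (β : ℝ≥0) {M N : ℕ} (a : Fin M ⊕ Fin N) :
    MeasurePreserving (thermostatMap a)
      ((maxwellian β M N).prod ((maxwell β).prod uniformAngle)) (maxwellian β M N) := by
  have h : MeasurePreserving
      (fun q : ((Velocities M N) × ℝ) × ℝ => thermostatMap a (q.1.1, (q.1.2, q.2)))
      (((maxwellian β M N).prod (maxwell β)).prod uniformAngle) (maxwellian β M N) :=
    measurePreserving_of_slices ((measurable_thermostatMap a).comp (by fun_prop))
      fun θ => measurePreserving_thermostat β a θ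
  exact h.comp (measurePreserving_prodAssoc _ _ _).symm

/-! ### The generators on `L²(Γ_{M+N})` -/

/-- The Hilbert space `L²(ℝ^{M+N}, Γ_{M+N})`. -/
abbrev L2 (β : ℝ≥0) (M N : ℕ) : Type := Lp ℝ 2 (maxwellian β M N)

section Generators

variable (β : ℝ≥0) (M N : ℕ)

/-- The collision operator `R_{a,b}` : averaging over the angle of a collision of the distinct
particles `a` and `b`. -/
def collisionOp {M N : ℕ} {a b : Fin M ⊕ Fin N} (hab : a ≠ b) : L2 β M N →L[ℝ] L2 β M N :=
  averageOp (measurePreserving_collisionMap β hab)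

/-- The thermostat operator `T_i` on the system particle `i`: averaging over the angle of a
collision with an external particle whose velocity is Maxwellian. -/
def thermostatOp {M : ℕ} (i : Fin M) : L2 β M N →L[ℝ] L2 β M N :=
  averageOp (measurePreserving_thermostatMap β (Sum.inl i : Fin M ⊕ Fin N))

/-- `𝓛_S = λ_S/(M-1) ∑_{i<j} (R^S_{i,j} - I)`. -/
def generatorS (lamS : ℝ) : L2 β M N →L[ℝ] L2 β M N :=
  (lamS / ((M : ℝ) - 1)) • ∑ p : {p : Fin M × Fin M // p.1 < p.2},
    (collisionOp β (M := M) (N := N) (Sum.inl_injective.ne p.2.ne) - 1)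

/-- `𝓛_R = λ_R/(N-1) ∑_{i<j} (R^R_{i,j} - I)`. -/
def generatorR (lamR : ℝ) : L2 β M N →L[ℝ] L2 β M N :=
  (lamR / ((N : ℝ) - 1)) • ∑ p : {p : Fin N × Fin N // p.1 < p.2},
    (collisionOp β (M := M) (N := N) (Sum.inr_injective.ne p.2.ne) - 1)

/-- `𝓛_I = μ/N ∑_{i≤M} ∑_{j≤N} (R^I_{i,j} - I)`. -/
def generatorI (mu : ℝ) : L2 β M N →L[ℝ] L2 β M N :=
  (mu / N) • ∑ i : Fin M, ∑ j : Fin N,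
    (collisionOp β (a := Sum.inl i) (b := Sum.inr j) Sum.inl_ne_inr - 1)

/-- `𝓛_T = μ ∑_{i≤M} (T_i - I)`. -/
def generatorT (mu : ℝ) : L2 β M N →L[ℝ] L2 β M N :=
  mu • ∑ i : Fin M, (thermostatOp β N i - 1)

/-- The generator `𝓛 = 𝓛_S + 𝓛_R + 𝓛_I` of the system coupled to the finite reservoir. -/
def generatorFR (lamS lamR mu : ℝ) : L2 β M N →L[ℝ] L2 β M N :=
  generatorS β M N lamS + generatorR β M N lamR + generatorI β M N mu

/-- The generator `𝓛_S + 𝓛_R + 𝓛_T` of the system coupled to the Maxwellian thermostat, acting on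
functions of all `M + N` velocities. -/
def generatorTh (lamS lamR mu : ℝ) : L2 β M N →L[ℝ] L2 β M N :=
  generatorS β M N lamS + generatorR β M N lamR + generatorT β M N mu

end Generators

end KacReservoir

end

/-!
On functions of the system velocities `T_i = P_j R_{i,j}`, where `P_a` is the conditional
expectation which averages over the velocity of the particle `a` and `j` is any reservoir particle.
Hence the differences `T_i f - R_{i,j} f`, for distinct `j`, are pairwise orthogonal, and each has
norm at most `‖f‖ / 2`; their sum over `j` therefore grows only like `√N`, and the two generators
differ by at most `(μ / 2) M / √N` on such functions.

On those functions of the system velocities which are orthogonal to the constants, the thermostat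
has a spectral gap of at least `μ / 2`: the quadratic form of `T_i` is at most `‖f‖² / 2` where
`P_i f = 0`, and an Efron–Stein inequality for the commuting projections `P_i` adds up the
particles.

Duhamel's formula `e^{tA} - e^{tB} = ∫₀ᵗ e^{(t-s)B} (A - B) e^{sA} ds`, in which `e^{(t-s)B}` is a
contraction and `e^{sA}` decays like `e^{-μs/2}`, combines the two estimates; the constants are
fixed by both semigroups.
-/

noncomputable section

namespace KacReservoir

/-! ### Symmetric projections -/

section SymmetricProjection

variable {H : Type*} [NormedAddCommGroup H] [InnerProductSpace ℝ H]

theorem inner_sub_norm_sq_le (x y : H) : inner ℝ x y - ‖x‖ ^ 2 ≤ 1 / 4 * ‖y‖ ^ 2 := by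
  have h : 0 ≤ ‖y - (2 : ℝ) • x‖ ^ 2 := sq_nonneg _
  rw [norm_sub_sq_real, inner_smul_right, real_inner_comm, norm_smul, mul_pow, Real.norm_two] at h
  linarith

theorem norm_sum_sq_of_pairwise_inner_eq_zero {ι : Type*} (s : Finset ι) {v : ι → H}
    (hv : Pairwise fun i j => inner ℝ (v i) (v j) = 0) :
    ‖∑ i ∈ s, v i‖ ^ 2 = ∑ i ∈ s, ‖v i‖ ^ 2 := by
  rw [← real_inner_self_eq_norm_sq, sum_inner]
  refine Finset.sum_congr rfl fun i hi => ?_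
  rw [inner_sum, Finset.sum_eq_single_of_mem i hi fun j _ hji => hv hji.symm,
    real_inner_self_eq_norm_sq]

section Single

variable {P Q R : H →ₗ[ℝ] H}

theorem isSymmetricProjection_of_norm_apply_le (hP : IsIdempotentElem P)
    (hc : ∀ x, ‖P x‖ ≤ ‖x‖) : P.IsSymmetricProjection := by
  refine ⟨hP, ?_⟩
  refine (LinearMap.IsIdempotentElem.isSymmetric_iff_isOrtho_range_ker hP).2
    (Submodule.isOrtho_iff_inner_eq.2 ?_)
  intro y hy z hz
  have hPy : P y = y := (LinearMap.IsIdempotentElem.mem_range_iff hP).1 hy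
  -- The line `y + t z` through `y` is mapped to `y`, which is hence its point of least norm.
  have hquad : ∀ t : ℝ, 0 ≤ ‖z‖ ^ 2 * (t * t) + 2 * inner ℝ y z * t + 0 := fun t => by
    have h := hc (y + t • z)
    rw [map_add, map_smul, LinearMap.mem_ker.1 hz, smul_zero, add_zero, hPy] at h
    have hsq := pow_le_pow_left₀ (norm_nonneg _) h 2
    rw [norm_add_sq_real, inner_smul_right, norm_smul, mul_pow, Real.norm_eq_abs, sq_abs] at hsq
    linarith
  have hdiscrim := discrim_le_zero hquad
  rw [discrim] at hdiscrim
  exact sq_eq_zero_iff.1 (le_antisymm (by linarith) (sq_nonneg _))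

theorem inner_apply_self_eq_norm_sq (hP : P.IsSymmetricProjection) (x : H) :
    inner ℝ (P x) x = ‖P x‖ ^ 2 := by
  have hidem : P (P x) = P x := LinearMap.congr_fun hP.isIdempotentElem x
  rw [← real_inner_self_eq_norm_sq, ← hP.isSymmetric, hidem]

theorem norm_sq_eq_norm_apply_sq_add (hP : P.IsSymmetricProjection) (x : H) :
    ‖x‖ ^ 2 = ‖P x‖ ^ 2 + ‖x - P x‖ ^ 2 := by
  rw [norm_sub_sq_real, real_inner_comm, inner_apply_self_eq_norm_sq hP]
  ring

theorem norm_apply_le_of_isSymmetricProjection (hP : P.IsSymmetricProjection) (x : H) :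
    ‖P x‖ ≤ ‖x‖ := by
  refine le_of_sq_le_sq ?_ (norm_nonneg _)
  linarith [norm_sq_eq_norm_apply_sq_add hP x, sq_nonneg ‖x - P x‖]

theorem norm_apply_sq_add_norm_apply_sq_le (hP : P.IsSymmetricProjection)
    (hQ : Q.IsSymmetricProjection) {x : H} (hPQ : inner ℝ (P x) (Q x) = 0) :
    ‖P x‖ ^ 2 + ‖Q x‖ ^ 2 ≤ ‖x‖ ^ 2 := by
  have h : 0 ≤ ‖x - (P x + Q x)‖ ^ 2 := sq_nonneg _
  rw [norm_sub_sq_real, norm_add_sq_real, inner_add_right, hPQ, real_inner_comm,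
    inner_apply_self_eq_norm_sq hP, real_inner_comm, inner_apply_self_eq_norm_sq hQ] at h
  linarith

theorem norm_apply_sq_le_half (hP : P.IsSymmetricProjection) (hQ : Q.IsSymmetricProjection)
    (hR : R.IsSymmetricProjection) {x : H} (hQx : Q x = x)
    (horth : inner ℝ (P (R x)) (Q (R x)) = 0) (hnorm : ‖P (R x)‖ = ‖Q (R x)‖) :
    ‖R x‖ ^ 2 ≤ 1 / 2 * ‖x‖ ^ 2 := by
  have hinner : inner ℝ (Q (R x)) x = ‖R x‖ ^ 2 := by
    rw [hQ.isSymmetric, hQx, inner_apply_self_eq_norm_sq hR]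
  have hbessel := norm_apply_sq_add_norm_apply_sq_le hP hQ horth
  have hquarter := inner_sub_norm_sq_le (Q (R x)) x
  rw [hnorm] at hbessel
  rw [hinner] at hquarter
  linarith

end Single

/-- The common fixed points of a family of operators. For conditional expectations these are the
functions measurable with respect to all of the conditioning σ-algebras. -/
def fixedSubspace {ι : Type*} (P : ι → H →L[ℝ] H) : Submodule ℝ H :=
  ⨅ a, LinearMap.eqLocus (P a : H →ₗ[ℝ] H) 1

section FixedSubspace

variable {ι : Type*} {P : ι → H →L[ℝ] H}

theorem mem_fixedSubspace {x : H} : x ∈ fixedSubspace P ↔ ∀ a, P a x = x := by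
  simp [fixedSubspace]

theorem apply_mem_fixedSubspace {T : H →L[ℝ] H} (hT : ∀ a, Commute (P a) T) {x : H}
    (hx : x ∈ fixedSubspace P) : T x ∈ fixedSubspace P :=
  mem_fixedSubspace.2 fun a => by
    rw [← mul_apply_eq_comp, (hT a).eq, mul_apply_eq_comp, mem_fixedSubspace.1 hx a]

theorem isClosed_fixedSubspace : IsClosed (fixedSubspace P : Set H) := by
  have h : (fixedSubspace P : Set H) = ⋂ a, {x | P a x = x} := by
    ext x
    simp [mem_fixedSubspace]
  rw [h]
  exact isClosed_iInter fun a => isClosed_eq (P a).continuous continuous_id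

theorem exists_fixed_norm_sub_sq_le (hP : ∀ a, (P a : H →ₗ[ℝ] H).IsSymmetricProjection)
    (hcomm : ∀ a b, Commute (P a) (P b)) (s : Finset ι) (x : H) :
    ∃ y, (∀ a ∈ s, P a y = y) ∧ ‖x - y‖ ^ 2 ≤ ∑ a ∈ s, ‖x - P a x‖ ^ 2 := by
  classical
  induction s using Finset.induction_on with
  | empty => exact ⟨x, by simp⟩
  | insert a s ha ih =>
    obtain ⟨y, hfix, hle⟩ := ih
    have hidem : ∀ z, P a (P a z) = P a z := LinearMap.congr_fun (hP a).isIdempotentElem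
    refine ⟨P a y, fun b hb => ?_, ?_⟩
    · obtain rfl | hb := Finset.mem_insert.1 hb
      · exact hidem y
      · rw [← mul_apply_eq_comp, (hcomm b a).eq, mul_apply_eq_comp, hfix b hb]
    · have hpyth := norm_sq_eq_norm_apply_sq_add (hP a) (x - P a y)
      have hcontr := norm_apply_le_of_isSymmetricProjection (hP a) (x - y)
      simp only [ContinuousLinearMap.coe_coe, map_sub, hidem,
        sub_sub_sub_cancel_right] at hpyth hcontr
      rw [Finset.sum_insert ha, hpyth, add_comm]
      gcongr
      exact (pow_le_pow_left₀ (norm_nonneg _) hcontr 2).trans hle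

-- An Efron–Stein inequality.
theorem norm_sq_le_sum_norm_sub_sq [Fintype ι]
    (hP : ∀ a, (P a : H →ₗ[ℝ] H).IsSymmetricProjection) (hcomm : ∀ a b, Commute (P a) (P b))
    {x : H} (hx : x ∈ (fixedSubspace P)ᗮ) :
    ‖x‖ ^ 2 ≤ ∑ a, ‖x - P a x‖ ^ 2 := by
  obtain ⟨y, hfix, hle⟩ := exists_fixed_norm_sub_sq_le hP hcomm Finset.univ x
  have hy : y ∈ fixedSubspace P := mem_fixedSubspace.2 fun a => hfix a (Finset.mem_univ a)
  rw [norm_sub_sq_real, Submodule.inner_left_of_mem_orthogonal hy hx] at hle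
  linarith [sq_nonneg ‖y‖]

end FixedSubspace

/-- The operator `c ∑ a, (P a - 1)`: the generator of the process in which each of the transitions
`P a` takes place at rate `c`. -/
def jumpGenerator {ι : Type*} [Fintype ι] (c : ℝ) (P : ι → H →L[ℝ] H) : H →L[ℝ] H :=
  c • ∑ a, (P a - 1)

section JumpGenerator

variable {ι : Type*} [Fintype ι] {P : ι → H →L[ℝ] H} {c : ℝ}

theorem jumpGenerator_apply (x : H) : jumpGenerator c P x = c • ∑ a, (P a x - x) := by
  simp [jumpGenerator, smul_apply, sum_apply, sub_apply]

theorem jumpGenerator_apply_eq_zero {x : H} (hx : x ∈ fixedSubspace P) :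
    jumpGenerator c P x = 0 := by
  simp [jumpGenerator_apply, mem_fixedSubspace.1 hx]

theorem commute_jumpGenerator {T : H →L[ℝ] H} (hT : ∀ a, Commute T (P a)) :
    Commute T (jumpGenerator c P) :=
  (Commute.sum_right _ _ _ fun a _ => (hT a).sub_right (Commute.one_right T)).smul_right c

theorem inner_jumpGenerator_left {x y : H} (h : ∀ a, inner ℝ (P a x) y = inner ℝ x (P a y)) :
    inner ℝ (jumpGenerator c P x) y = inner ℝ x (jumpGenerator c P y) := by
  simp only [jumpGenerator_apply, real_inner_smul_left, real_inner_smul_right, sum_inner,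
    inner_sum, inner_sub_left, inner_sub_right, h]

theorem inner_jumpGenerator_self_nonpos (hP : ∀ a, (P a : H →ₗ[ℝ] H).IsSymmetricProjection)
    (hc : 0 ≤ c) (x : H) : inner ℝ (jumpGenerator c P x) x ≤ 0 := by
  rw [jumpGenerator_apply, real_inner_smul_left, sum_inner]
  refine mul_nonpos_of_nonneg_of_nonpos hc (Finset.sum_nonpos fun a _ => ?_)
  have hself : inner ℝ (P a x) x = ‖P a x‖ ^ 2 := inner_apply_self_eq_norm_sq (hP a) x
  rw [inner_sub_left, hself, real_inner_self_eq_norm_sq, sub_nonpos]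
  exact pow_le_pow_left₀ (norm_nonneg _) (norm_apply_le_of_isSymmetricProjection (hP a) x) 2

theorem inner_jumpGenerator_pairs_nonpos {n : ℕ}
    {P : {p : Fin n × Fin n // p.1 < p.2} → H →L[ℝ] H}
    (hP : ∀ p, (P p : H →ₗ[ℝ] H).IsSymmetricProjection) (hc : 0 ≤ c) (x : H) :
    inner ℝ (jumpGenerator (c / ((n : ℝ) - 1)) P x) x ≤ 0 := by
  -- For `n = 0` the factor `n - 1` is negative, but there are no pairs.
  obtain rfl | hn := Nat.eq_zero_or_pos n
  · simp [jumpGenerator_apply]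
  · have hn' : (1 : ℝ) ≤ n := by exact_mod_cast hn
    exact inner_jumpGenerator_self_nonpos hP (div_nonneg hc (sub_nonneg.2 hn')) x

end JumpGenerator

end SymmetricProjection

/-! ### One-parameter semigroups -/

section Semigroup

theorem le_exp_mul_of_deriv_le {f f' : ℝ → ℝ} {K t : ℝ} (hf : ∀ s, HasDerivAt f (f' s) s)
    (hbound : ∀ s, f' s ≤ K * f s) (ht : 0 ≤ t) : f t ≤ f 0 * Real.exp (K * t) := by
  have h := le_gronwallBound_of_liminf_deriv_right_le (ε := 0)
    (fun s _ => (hf s).continuousAt.continuousWithinAt)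
    (fun s _ _ hr => (hf s).hasDerivWithinAt.liminf_right_slope_le hr) (le_refl (f 0))
    (fun s _ => by simpa using hbound s) t (Set.right_mem_Icc.2 ht)
  rwa [gronwallBound_ε0, sub_zero] at h

section Banach

variable {E : Type*} [NormedAddCommGroup E] [NormedSpace ℝ E] [CompleteSpace E] {A B : E →L[ℝ] E}

theorem hasDerivAt_exp_smul_apply (A : E →L[ℝ] E) (x : E) (t : ℝ) :
    HasDerivAt (fun s : ℝ => NormedSpace.exp (s • A) x) (A (NormedSpace.exp (t • A) x)) t :=
  (ContinuousLinearMap.apply ℝ E x).hasFDerivAt.comp_hasDerivAt t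
    (hasDerivAt_exp_smul_const' (𝕂 := ℝ) A t)

theorem exp_smul_apply_mem {V : Submodule ℝ E} (hV : IsClosed (V : Set E))
    (hA : ∀ x ∈ V, A x ∈ V) {x : E} (hx : x ∈ V) (t : ℝ) : NormedSpace.exp (t • A) x ∈ V := by
  have hpow : ∀ n : ℕ, ((t • A) ^ n) x ∈ V := fun n => by
    induction n with
    | zero => simpa using hx
    | succ n ih =>
      rw [pow_succ', mul_apply_eq_comp]
      exact V.smul_mem _ (hA _ ih)
  have hsum := (NormedSpace.exp_series_hasSum_exp' (𝕂 := ℝ) (t • A)).mapL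
    (ContinuousLinearMap.apply ℝ E x)
  exact hV.mem_of_tendsto hsum (Filter.Eventually.of_forall fun s =>
    V.sum_mem fun n _ => V.smul_mem _ (hpow n))

theorem exp_smul_apply_of_apply_eq_zero {x : E} (hx : A x = 0) (t : ℝ) :
    NormedSpace.exp (t • A) x = x := by
  have hderiv : ∀ s : ℝ, HasDerivAt (fun s : ℝ => NormedSpace.exp (s • A) x) 0 s := fun s => by
    refine ((ContinuousLinearMap.apply ℝ E x).hasFDerivAt.comp_hasDerivAt s
      (hasDerivAt_exp_smul_const (𝕂 := ℝ) A s)).congr_deriv ?_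
    change NormedSpace.exp (s • A) (A x) = 0
    rw [hx, map_zero]
  simpa using is_const_of_deriv_eq_zero (fun s => (hderiv s).differentiableAt)
    (fun s => (hderiv s).deriv) t 0

theorem hasDerivAt_exp_smul_exp_smul_apply (A B : E →L[ℝ] E) (x : E) (t s : ℝ) :
    HasDerivAt (fun s : ℝ => NormedSpace.exp ((t - s) • B) (NormedSpace.exp (s • A) x))
      (NormedSpace.exp ((t - s) • B) ((A - B) (NormedSpace.exp (s • A) x))) s := by
  have hB : HasDerivAt (fun s : ℝ => NormedSpace.exp ((t - s) • B))
      ((-1 : ℝ) • (NormedSpace.exp ((t - s) • B) * B)) s :=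
    (hasDerivAt_exp_smul_const (𝕂 := ℝ) B (t - s)).scomp s
      (by simpa using (hasDerivAt_id s).const_sub t)
  refine (hB.clm_apply (hasDerivAt_exp_smul_apply A x s)).congr_deriv ?_
  rw [smul_apply, mul_apply_eq_comp, sub_apply, map_sub, neg_one_smul, neg_add_eq_sub]

-- Duhamel's formula, in the form of the mean value inequality for `s ↦ e^{(t-s)B} e^{sA} x`.
theorem norm_exp_smul_sub_exp_smul_le {x : E} {c K : ℝ}
    (hB : ∀ s : ℝ, 0 ≤ s → ∀ y, ‖NormedSpace.exp (s • B) y‖ ≤ ‖y‖)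
    (hAB : ∀ s : ℝ, 0 ≤ s → ‖(A - B) (NormedSpace.exp (s • A) x)‖ ≤ K * c * Real.exp (-c * s))
    {t : ℝ} (ht : 0 ≤ t) :
    ‖NormedSpace.exp (t • A) x - NormedSpace.exp (t • B) x‖ ≤ K * (1 - Real.exp (-c * t)) := by
  have hpath (s : ℝ) := (hasDerivAt_exp_smul_exp_smul_apply A B x t s).sub_const
    (NormedSpace.exp (t • B) x)
  have hboundary : ∀ s, HasDerivAt (fun s => K * (1 - Real.exp (-c * s)))
      (K * c * Real.exp (-c * s)) s := fun s => by
    have hexp : HasDerivAt (fun s : ℝ => Real.exp (-c * s)) (Real.exp (-c * s) * (-c)) s := by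
      simpa using ((hasDerivAt_id s).const_mul (-c)).exp
    exact ((hexp.const_sub 1).const_mul K).congr_deriv (by ring)
  simpa using image_norm_le_of_norm_deriv_right_le_deriv_boundary (a := 0) (b := t)
    (fun s _ => (hpath s).continuousAt.continuousWithinAt) (fun s _ => (hpath s).hasDerivWithinAt)
    (by simp) hboundary
    (fun s hs => (hB _ (sub_nonneg.2 hs.2.le) _).trans (hAB s hs.1)) (Set.right_mem_Icc.2 ht)

end Banach

section Hilbert

variable {H : Type*} [NormedAddCommGroup H] [InnerProductSpace ℝ H] [CompleteSpace H]
  {A B : H →L[ℝ] H}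

theorem norm_exp_smul_apply_le {U : Submodule ℝ H} (hU : IsClosed (U : Set H))
    (hAU : ∀ x ∈ U, A x ∈ U) {c : ℝ} (hA : ∀ x ∈ U, inner ℝ (A x) x ≤ -c * ‖x‖ ^ 2) {x : H}
    (hx : x ∈ U) {t : ℝ} (ht : 0 ≤ t) :
    ‖NormedSpace.exp (t • A) x‖ ≤ ‖x‖ * Real.exp (-c * t) := by
  have hbound : ∀ s : ℝ, 2 * inner ℝ (NormedSpace.exp (s • A) x) (A (NormedSpace.exp (s • A) x)) ≤
      2 * -c * ‖NormedSpace.exp (s • A) x‖ ^ 2 := fun s => by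
    have h := hA _ (exp_smul_apply_mem hU hAU hx s)
    rw [real_inner_comm] at h
    linarith
  have hsq := le_exp_mul_of_deriv_le (fun s => (hasDerivAt_exp_smul_apply A x s).norm_sq) hbound ht
  refine le_of_sq_le_sq ?_ (by positivity)
  rw [mul_pow, ← Real.exp_nat_mul, Nat.cast_ofNat, ← mul_assoc]
  simpa using hsq

theorem norm_exp_smul_apply_le_norm (hA : ∀ x, inner ℝ (A x) x ≤ 0) (x : H) {t : ℝ}
    (ht : 0 ≤ t) : ‖NormedSpace.exp (t • A) x‖ ≤ ‖x‖ := by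
  simpa using norm_exp_smul_apply_le (U := ⊤) (c := 0) isClosed_univ (by simp)
    (by simpa using hA) (Submodule.mem_top (x := x)) ht

theorem norm_exp_smul_sub_exp_smul_le_of_inner_le {U : Submodule ℝ H} (hU : IsClosed (U : Set H))
    (hAU : ∀ x ∈ U, A x ∈ U) {c K : ℝ} (hKc : 0 ≤ K * c)
    (hA : ∀ x ∈ U, inner ℝ (A x) x ≤ -c * ‖x‖ ^ 2) (hB : ∀ x, inner ℝ (B x) x ≤ 0)
    (hAB : ∀ x ∈ U, ‖(A - B) x‖ ≤ K * c * ‖x‖) {x : H} (hx : x ∈ U) {t : ℝ} (ht : 0 ≤ t) :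
    ‖NormedSpace.exp (t • A) x - NormedSpace.exp (t • B) x‖ ≤
      K * (1 - Real.exp (-c * t)) * ‖x‖ := by
  rw [mul_right_comm]
  refine norm_exp_smul_sub_exp_smul_le (fun s hs y => norm_exp_smul_apply_le_norm hB y hs)
    (fun s hs => ?_) ht
  calc ‖(A - B) (NormedSpace.exp (s • A) x)‖
      ≤ K * c * ‖NormedSpace.exp (s • A) x‖ := hAB _ (exp_smul_apply_mem hU hAU hx s)
    _ ≤ K * c * (‖x‖ * Real.exp (-c * s)) := by
        gcongr
        exact norm_exp_smul_apply_le hU hAU hA hx hs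
    _ = K * ‖x‖ * c * Real.exp (-c * s) := by ring

end Hilbert

end Semigroup

/-! ### Calculus of averaging operators -/

section AverageCalculus

variable {X Θ Θ' : Type*} [MeasurableSpace X] [MeasurableSpace Θ] [MeasurableSpace Θ']
  {m : Measure X} {ν : Measure Θ} {ν' : Measure Θ'} {φ : X × Θ → X} {ψ : X × Θ' → X}

/-- The transition which follows `φ` by `ψ`, with independent parameters. It represents the product
of the averaging operators in the same order. -/
def stepMap (φ : X × Θ → X) (ψ : X × Θ' → X) (p : X × (Θ × Θ')) : X :=
  ψ (φ (p.1, p.2.1), p.2.2)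

theorem measurePreserving_stepMap [SFinite m] [SFinite ν] [SFinite ν']
    (hφ : MeasurePreserving φ (m.prod ν) m) (hψ : MeasurePreserving ψ (m.prod ν') m) :
    MeasurePreserving (stepMap φ ψ) (m.prod (ν.prod ν')) m :=
  (hψ.comp (hφ.prod (MeasurePreserving.id ν'))).comp (measurePreserving_prodAssoc m ν ν').symm

variable [IsFiniteMeasure m] [IsProbabilityMeasure ν] [IsProbabilityMeasure ν']

theorem coeFn_averageOp (hφ : MeasurePreserving φ (m.prod ν) m) (f : Lp ℝ 2 m) :
    averageOp hφ f =ᵐ[m] average ν φ f :=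
  MemLp.coeFn_toLp (memLp_average hφ (Lp.memLp f))

theorem norm_averageOp_apply_le (hφ : MeasurePreserving φ (m.prod ν) m) (f : Lp ℝ 2 m) :
    ‖averageOp hφ f‖ ≤ ‖f‖ := by
  rw [Lp.norm_def, Lp.norm_def, eLpNorm_congr_ae (coeFn_averageOp hφ f)]
  exact ENNReal.toReal_mono (Lp.eLpNorm_ne_top f) (eLpNorm_average_le hφ (Lp.memLp f))

theorem isSymmetricProjection_averageOp {hφ : MeasurePreserving φ (m.prod ν) m}
    (h : IsIdempotentElem (averageOp hφ)) :
    (averageOp hφ : Lp ℝ 2 m →ₗ[ℝ] Lp ℝ 2 m).IsSymmetricProjection :=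
  isSymmetricProjection_of_norm_apply_le
    (LinearMap.ext fun f => DFunLike.congr_fun h.eq f) (norm_averageOp_apply_le hφ)

theorem averageOp_toLp_of_invariant (hφ : MeasurePreserving φ (m.prod ν) m) {f : X → ℝ}
    (hf : MemLp f 2 m) (h : ∀ x θ, f (φ (x, θ)) = f x) :
    averageOp hφ (hf.toLp f) = hf.toLp f := by
  have havg : average ν φ f = f := funext fun x => by simp [average, h]
  refine Lp.ext ((coeFn_averageOp hφ _).trans ((average_congr hφ hf.coeFn_toLp).trans ?_))
  rw [havg]
  exact hf.coeFn_toLp.symm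

theorem averageOp_mul_averageOp_of_average_invariant (hφ : MeasurePreserving φ (m.prod ν) m)
    (hψ : MeasurePreserving ψ (m.prod ν') m)
    (h : ∀ (f : X → ℝ) x θ, average ν' ψ f (φ (x, θ)) = average ν' ψ f x) :
    averageOp hφ * averageOp hψ = averageOp hψ :=
  ContinuousLinearMap.ext fun f =>
    averageOp_toLp_of_invariant hφ (memLp_average hψ (Lp.memLp f)) (h f)

theorem averageOp_mul_averageOp (hφ : MeasurePreserving φ (m.prod ν) m)
    (hψ : MeasurePreserving ψ (m.prod ν') m) :
    averageOp hφ * averageOp hψ = averageOp (measurePreserving_stepMap hφ hψ) := by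
  ext1 f
  refine Lp.ext ((coeFn_averageOp hφ _).trans <| (average_congr hφ (coeFn_averageOp hψ f)).trans <|
    Filter.EventuallyEq.trans ?_ (coeFn_averageOp (measurePreserving_stepMap hφ hψ) f).symm)
  filter_upwards [ae_integrable_slice (measurePreserving_stepMap hφ hψ) (Lp.memLp f)] with x hx
  exact (integral_prod _ hx).symm

theorem averageOp_eq_of_measurePreserving (hφ : MeasurePreserving φ (m.prod ν) m)
    (hψ : MeasurePreserving ψ (m.prod ν') m) {e : Θ → Θ'} (he : MeasurePreserving e ν ν')
    (h : ∀ x θ, φ (x, θ) = ψ (x, e θ)) : averageOp hφ = averageOp hψ := by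
  ext1 f
  refine Lp.ext ((coeFn_averageOp hφ f).trans <|
    Filter.EventuallyEq.trans ?_ (coeFn_averageOp hψ f).symm)
  filter_upwards [ae_integrable_slice hψ (Lp.memLp f)] with x hx
  simp only [average, h]
  rw [← he.map_eq, integral_map he.measurable.aemeasurable]
  rw [he.map_eq]
  exact hx.aestronglyMeasurable

end AverageCalculus

/-! ### Refreshing a velocity -/

section Maps

variable {ι : Type*} [DecidableEq ι]

/-- Replacement of the velocity of the particle `a`, as a function of the pair (velocities, new
velocity). -/
def refreshMap (a : ι) (p : (ι → ℝ) × ℝ) : ι → ℝ := Function.update p.1 a p.2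

theorem collisionMap_collisionMap {a b : ι} (hab : a ≠ b) (x : ι → ℝ) (θ α : ℝ) :
    collisionMap a b (collisionMap a b (x, α), θ) = collisionMap a b (x, θ + α) := by
  ext k
  simp only [collisionMap, hab.symm, if_true, if_false, Real.cos_add, Real.sin_add]
  split_ifs <;> ring

-- A collision at a right angle exchanges the velocities of `a` and `b`, up to a sign.
theorem collisionMap_refreshMap_pi_div_two {a b : ι} (hab : a ≠ b) (x : ι → ℝ) (u : ℝ) :
    collisionMap a b (refreshMap b (x, u), Real.pi / 2) =
      refreshMap a (collisionMap a b (x, Real.pi / 2), u) := by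
  ext k
  simp only [refreshMap, collisionMap, Function.update_apply, Real.cos_pi_div_two,
    Real.sin_pi_div_two]
  split_ifs <;> simp_all

theorem integral_uniformAngle (g : ℝ → ℝ) :
    ∫ θ, g θ ∂uniformAngle = (2 * Real.pi)⁻¹ * ∫ θ in (0 : ℝ)..2 * Real.pi, g θ := by
  rw [uniformAngle, ProbabilityTheory.cond, integral_smul_measure,
    intervalIntegral.integral_of_le Real.two_pi_pos.le]
  simp [Real.pi_pos.le]

theorem average_collisionMap_collisionMap {a b : ι} (hab : a ≠ b) (f : (ι → ℝ) → ℝ) (x : ι → ℝ)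
    (α : ℝ) :
    average uniformAngle (collisionMap a b) f (collisionMap a b (x, α)) =
      average uniformAngle (collisionMap a b) f x := by
  have hper : Function.Periodic (fun θ => f (collisionMap a b (x, θ))) (2 * Real.pi) := fun θ => by
    have h : collisionMap a b (x, θ + 2 * Real.pi) = collisionMap a b (x, θ) := by
      ext k
      simp only [collisionMap, Real.cos_add_two_pi, Real.sin_add_two_pi]
    simp only [h]
  simp only [average, collisionMap_collisionMap hab, integral_uniformAngle]
  rw [intervalIntegral.integral_comp_add_right fun θ => f (collisionMap a b (x, θ)), zero_add,
    add_comm (2 * Real.pi), hper.intervalIntegral_add_eq α 0, zero_add]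

end Maps

section Refresh

variable (β : ℝ≥0) {M N : ℕ}

theorem measurePreserving_refreshMap (a : Fin M ⊕ Fin N) :
    MeasurePreserving (refreshMap a) ((maxwellian β M N).prod (maxwell β)) (maxwellian β M N) := by
  have h : refreshMap a = fun p => thermostatMap a (p.1, (p.2, Real.pi / 2)) := by
    ext p
    simp [thermostatMap, refreshMap]
  rw [h]
  exact measurePreserving_thermostat β a (Real.pi / 2)

/-- The conditional expectation given the velocities of the particles other than `a`. -/
def refreshOp (a : Fin M ⊕ Fin N) : L2 β M N →L[ℝ] L2 β M N :=
  averageOp (measurePreserving_refreshMap β a)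

theorem isIdempotentElem_refreshOp (a : Fin M ⊕ Fin N) : IsIdempotentElem (refreshOp β a) := by
  rw [IsIdempotentElem, refreshOp, averageOp_mul_averageOp]
  refine averageOp_eq_of_measurePreserving _ _ measurePreserving_snd fun x u => ?_
  simp [stepMap, refreshMap]

theorem commute_refreshOp_refreshOp (a b : Fin M ⊕ Fin N) :
    Commute (refreshOp β a) (refreshOp β b) := by
  obtain rfl | hab := eq_or_ne a b
  · exact Commute.refl _
  rw [Commute, SemiconjBy, refreshOp, refreshOp, averageOp_mul_averageOp, averageOp_mul_averageOp]
  exact averageOp_eq_of_measurePreserving _ _ Measure.measurePreserving_swap fun x u =>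
    Function.update_comm hab _ _ _

theorem commute_refreshOp_collisionOp {a b c : Fin M ⊕ Fin N} (hab : a ≠ b) (hca : c ≠ a)
    (hcb : c ≠ b) : Commute (refreshOp β c) (collisionOp β hab) := by
  rw [Commute, SemiconjBy, refreshOp, collisionOp, averageOp_mul_averageOp,
    averageOp_mul_averageOp]
  refine averageOp_eq_of_measurePreserving _ _ Measure.measurePreserving_swap fun x u => ?_
  ext k
  simp only [stepMap, refreshMap, collisionMap, Prod.fst_swap, Prod.snd_swap,
    Function.update_apply, hca.symm, hcb.symm, if_false]
  split_ifs <;> simp_all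

theorem commute_refreshOp_thermostatOp {i : Fin M} {c : Fin M ⊕ Fin N} (hc : c ≠ Sum.inl i) :
    Commute (refreshOp β c) (thermostatOp β N i) := by
  rw [Commute, SemiconjBy, refreshOp, thermostatOp, averageOp_mul_averageOp,
    averageOp_mul_averageOp]
  refine averageOp_eq_of_measurePreserving _ _ Measure.measurePreserving_swap fun x u => ?_
  simp only [stepMap, refreshMap, thermostatMap, Prod.fst_swap, Prod.snd_swap,
    Function.update_of_ne hc.symm]
  exact Function.update_comm hc _ _ _

theorem collisionOp_mul_refreshOp_mul_refreshOp {a b : Fin M ⊕ Fin N} (hab : a ≠ b) :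
    collisionOp β hab * (refreshOp β a * refreshOp β b) = refreshOp β a * refreshOp β b := by
  rw [refreshOp, refreshOp, collisionOp, averageOp_mul_averageOp, averageOp_mul_averageOp]
  refine averageOp_eq_of_measurePreserving _ _ measurePreserving_snd fun x u => ?_
  ext k
  simp only [stepMap, refreshMap, collisionMap, Function.update_apply]
  split_ifs <;> simp_all

theorem thermostatOp_mul_refreshOp_inl (i : Fin M) :
    thermostatOp β N i * refreshOp β (Sum.inl i) = refreshOp β (Sum.inl i) := by
  rw [refreshOp, thermostatOp, averageOp_mul_averageOp]
  refine averageOp_eq_of_measurePreserving _ _ measurePreserving_snd fun x u => ?_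
  simp [stepMap, refreshMap, thermostatMap]

-- The reservoir particle `j` serves as the external particle of the thermostat.
theorem thermostatOp_mul_refreshOp_inr (i : Fin M) (j : Fin N) :
    thermostatOp β N i * refreshOp β (Sum.inr j) =
      refreshOp β (Sum.inr j) * (collisionOp β (a := Sum.inl i) (b := Sum.inr j) Sum.inl_ne_inr *
        refreshOp β (Sum.inr j)) := by
  rw [refreshOp, thermostatOp, collisionOp, averageOp_mul_averageOp, averageOp_mul_averageOp,
    averageOp_mul_averageOp]
  refine averageOp_eq_of_measurePreserving _ _
    (measurePreserving_prodAssoc (maxwell β) uniformAngle (maxwell β)) fun x u => ?_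
  ext k
  simp only [stepMap, refreshMap, thermostatMap, collisionMap, Function.update_apply,
    MeasurableEquiv.prodAssoc, MeasurableEquiv.coe_mk, Equiv.prodAssoc_apply]
  split_ifs <;> simp_all

theorem isIdempotentElem_collisionOp {a b : Fin M ⊕ Fin N} (hab : a ≠ b) :
    IsIdempotentElem (collisionOp β hab) :=
  averageOp_mul_averageOp_of_average_invariant _ _
    (average_collisionMap_collisionMap hab)

theorem isSymmetricProjection_refreshOp (a : Fin M ⊕ Fin N) :
    (refreshOp β a : L2 β M N →ₗ[ℝ] L2 β M N).IsSymmetricProjection :=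
  isSymmetricProjection_averageOp (isIdempotentElem_refreshOp β a)

theorem isSymmetricProjection_collisionOp {a b : Fin M ⊕ Fin N} (hab : a ≠ b) :
    (collisionOp β hab : L2 β M N →ₗ[ℝ] L2 β M N).IsSymmetricProjection :=
  isSymmetricProjection_averageOp (isIdempotentElem_collisionOp β hab)

theorem inner_refreshOp_left (a : Fin M ⊕ Fin N) (f g : L2 β M N) :
    inner ℝ (refreshOp β a f) g = inner ℝ f (refreshOp β a g) :=
  (isSymmetricProjection_refreshOp β a).isSymmetric f g

theorem inner_collisionOp_left {a b : Fin M ⊕ Fin N} (hab : a ≠ b) (f g : L2 β M N) :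
    inner ℝ (collisionOp β hab f) g = inner ℝ f (collisionOp β hab g) :=
  (isSymmetricProjection_collisionOp β hab).isSymmetric f g

theorem collisionOp_apply_of_refreshOp_eq {a b : Fin M ⊕ Fin N} (hab : a ≠ b) {f : L2 β M N}
    (ha : refreshOp β a f = f) (hb : refreshOp β b f = f) : collisionOp β hab f = f := by
  simpa only [mul_apply_eq_comp, ha, hb] using
    DFunLike.congr_fun (collisionOp_mul_refreshOp_mul_refreshOp β hab) f

theorem norm_refreshOp_collisionOp {a b : Fin M ⊕ Fin N} (hab : a ≠ b) (f : L2 β M N) :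
    ‖refreshOp β b (collisionOp β hab f)‖ = ‖refreshOp β a (collisionOp β hab f)‖ := by
  set g := average uniformAngle (collisionMap a b) f
  have hg : MemLp g 2 (maxwellian β M N) :=
    memLp_average (measurePreserving_collisionMap β hab) (Lp.memLp f)
  have hcoe : ∀ c, refreshOp β c (collisionOp β hab f) =ᵐ[maxwellian β M N]
      average (maxwell β) (refreshMap c) g := fun c =>
    (coeFn_averageOp _ _).trans (average_congr (measurePreserving_refreshMap β c)
      (coeFn_averageOp (measurePreserving_collisionMap β hab) f))
  have hrot : average (maxwell β) (refreshMap b) g =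
      average (maxwell β) (refreshMap a) g ∘ fun x => collisionMap a b (x, Real.pi / 2) := by
    ext x
    refine integral_congr_ae (Filter.Eventually.of_forall fun u => ?_)
    change g (refreshMap b (x, u)) = g (refreshMap a (collisionMap a b (x, Real.pi / 2), u))
    rw [← collisionMap_refreshMap_pi_div_two hab]
    exact (average_collisionMap_collisionMap hab f _ _).symm
  rw [Lp.norm_def, Lp.norm_def, eLpNorm_congr_ae (hcoe b), eLpNorm_congr_ae (hcoe a), hrot]
  exact congrArg ENNReal.toReal (eLpNorm_comp_measurePreserving
    (aestronglyMeasurable_average (measurePreserving_refreshMap β a) hg)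
    (measurePreserving_collision β hab (Real.pi / 2)))

end Refresh

/-! ### Functions of the system velocities -/

section System

variable (β : ℝ≥0) {M N : ℕ}

/-- The collision operator `R^I_{i,j}` of the system particle `i` and the reservoir particle `j`. -/
abbrev interactionOp (i : Fin M) (j : Fin N) : L2 β M N →L[ℝ] L2 β M N :=
  collisionOp β (a := Sum.inl i) (b := Sum.inr j) Sum.inl_ne_inr

variable {β}

theorem thermostatOp_apply_eq (i : Fin M) {j : Fin N} {f : L2 β M N}
    (hf : refreshOp β (Sum.inr j) f = f) :
    thermostatOp β N i f = refreshOp β (Sum.inr j) (interactionOp β i j f) := by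
  simpa only [mul_apply_eq_comp, hf] using
    DFunLike.congr_fun (thermostatOp_mul_refreshOp_inr β i j) f

theorem inner_thermostatOp (i : Fin M) {j : Fin N} {f g : L2 β M N}
    (hf : refreshOp β (Sum.inr j) f = f) (hg : refreshOp β (Sum.inr j) g = g) :
    inner ℝ (thermostatOp β N i f) g = inner ℝ (interactionOp β i j f) g := by
  rw [thermostatOp_apply_eq i hf, inner_refreshOp_left, hg]

theorem inner_thermostatOp_left (i : Fin M) {j : Fin N} {f g : L2 β M N}
    (hf : refreshOp β (Sum.inr j) f = f) (hg : refreshOp β (Sum.inr j) g = g) :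
    inner ℝ (thermostatOp β N i f) g = inner ℝ f (thermostatOp β N i g) := by
  rw [inner_thermostatOp i hf hg, inner_collisionOp_left, real_inner_comm,
    ← inner_thermostatOp i hg hf, real_inner_comm]

theorem inner_interactionOp_thermostatOp (i : Fin M) {j : Fin N} {f : L2 β M N}
    (hf : refreshOp β (Sum.inr j) f = f) :
    inner ℝ (interactionOp β i j f) (thermostatOp β N i f) = ‖thermostatOp β N i f‖ ^ 2 := by
  rw [thermostatOp_apply_eq i hf, real_inner_comm]
  exact inner_apply_self_eq_norm_sq (isSymmetricProjection_refreshOp β _) _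

theorem inner_interactionOp_interactionOp (i : Fin M) {j k : Fin N} (hjk : j ≠ k) {f : L2 β M N}
    (hj : refreshOp β (Sum.inr j) f = f) (hk : refreshOp β (Sum.inr k) f = f) :
    inner ℝ (interactionOp β i j f) (interactionOp β i k f) = ‖thermostatOp β N i f‖ ^ 2 := by
  have hfix : refreshOp β (Sum.inr k) (interactionOp β i j f) = interactionOp β i j f := by
    rw [← mul_apply_eq_comp, (commute_refreshOp_collisionOp β Sum.inl_ne_inr Sum.inr_ne_inl
      (Sum.inr_injective.ne hjk.symm)).eq, mul_apply_eq_comp, hk]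
  rw [← hfix, inner_refreshOp_left, ← thermostatOp_apply_eq i hk]
  exact inner_interactionOp_thermostatOp i hj

-- `R P_i P_j = P_i P_j` makes the two projections of `R f` orthogonal when `P_i f = 0`, and the
-- rotation by `π / 2` makes them equally long.
theorem norm_interactionOp_sq_le (i : Fin M) {j : Fin N} {f : L2 β M N}
    (hi : refreshOp β (Sum.inl i) f = 0) (hj : refreshOp β (Sum.inr j) f = f) :
    ‖interactionOp β i j f‖ ^ 2 ≤ 1 / 2 * ‖f‖ ^ 2 := by
  set g := interactionOp β i j f with hg
  set q : L2 β M N := refreshOp β (Sum.inl i) (refreshOp β (Sum.inr j) g) with hq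
  have hRq : interactionOp β i j q = q :=
    DFunLike.congr_fun (collisionOp_mul_refreshOp_mul_refreshOp β Sum.inl_ne_inr) g
  have hPq : refreshOp β (Sum.inl i) q = q :=
    DFunLike.congr_fun (isIdempotentElem_refreshOp β (Sum.inl i)).eq _
  have horth : inner ℝ (refreshOp β (Sum.inl i) g) (refreshOp β (Sum.inr j) g) = 0 := by
    rw [inner_refreshOp_left, ← hq, hg, inner_collisionOp_left, hRq, ← hPq,
      ← inner_refreshOp_left, hi, inner_zero_left]
  exact norm_apply_sq_le_half (isSymmetricProjection_refreshOp β (Sum.inl i))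
    (isSymmetricProjection_refreshOp β (Sum.inr j)) (isSymmetricProjection_collisionOp β _) hj horth
    (norm_refreshOp_collisionOp β Sum.inl_ne_inr f).symm

theorem inner_thermostatOp_self_le_half (i : Fin M) {j : Fin N} {f : L2 β M N}
    (hi : refreshOp β (Sum.inl i) f = 0) (hj : refreshOp β (Sum.inr j) f = f) :
    inner ℝ (thermostatOp β N i f) f ≤ 1 / 2 * ‖f‖ ^ 2 := by
  rw [inner_thermostatOp i hj hj]
  exact (inner_apply_self_eq_norm_sq (isSymmetricProjection_collisionOp β _) f).trans_le
    (norm_interactionOp_sq_le i hi hj)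

theorem inner_thermostatOp_sub_self_le (i : Fin M) {j : Fin N} {f : L2 β M N}
    (hj : refreshOp β (Sum.inr j) f = f) :
    inner ℝ (thermostatOp β N i f - f) f ≤ -(1 / 2) * ‖f - refreshOp β (Sum.inl i) f‖ ^ 2 := by
  set q := refreshOp β (Sum.inl i) f with hq
  set g := f - q with hg
  have hqi : refreshOp β (Sum.inl i) q = q :=
    DFunLike.congr_fun (isIdempotentElem_refreshOp β (Sum.inl i)).eq f
  have hqj : refreshOp β (Sum.inr j) q = q := by
    rw [hq, ← mul_apply_eq_comp, (commute_refreshOp_refreshOp β _ _).eq, mul_apply_eq_comp, hj]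
  have hgi : refreshOp β (Sum.inl i) g = 0 := by rw [hg, map_sub, hqi, sub_self]
  have hgj : refreshOp β (Sum.inr j) g = g := by rw [hg, map_sub, hj, hqj]
  have hTq : thermostatOp β N i q = q :=
    DFunLike.congr_fun (thermostatOp_mul_refreshOp_inl β i) f
  have hgq : inner ℝ g q = 0 := by
    rw [← hqi, ← inner_refreshOp_left, hgi, inner_zero_left]
  have hTgq : inner ℝ (thermostatOp β N i g) q = 0 := by
    rw [inner_thermostatOp_left i hgj hqj, hTq, hgq]
  have hTf : thermostatOp β N i f - f = thermostatOp β N i g - g := by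
    rw [hg, map_sub, hTq]
    abel
  have hsplit : ∀ x, inner ℝ x f = inner ℝ x g + inner ℝ x q := fun x => by
    rw [← inner_add_right, hg, sub_add_cancel]
  rw [hTf, hsplit, inner_sub_left (thermostatOp β N i g), inner_sub_left (thermostatOp β N i g),
    hTgq, hgq, real_inner_self_eq_norm_sq]
  linarith [inner_thermostatOp_self_le_half i hgi hgj]

variable (β M N)

/-- The functions which do not depend on the velocities of the reservoir particles. -/
def systemSubspace : Submodule ℝ (L2 β M N) := fixedSubspace fun j => refreshOp β (Sum.inr j)

/-- The functions which depend on none of the velocities, that is, the constants. -/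
def equilibriumSubspace : Submodule ℝ (L2 β M N) := fixedSubspace (refreshOp β)

instance : (equilibriumSubspace β M N).HasOrthogonalProjection :=
  haveI : CompleteSpace (equilibriumSubspace β M N) :=
    isClosed_fixedSubspace.completeSpace_coe
  inferInstance

/-- The functions of the system velocities which are orthogonal to the constants. -/
def centeredSystemSubspace : Submodule ℝ (L2 β M N) :=
  systemSubspace β M N ⊓ (equilibriumSubspace β M N)ᗮ

variable {β M N}

theorem isClosed_centeredSystemSubspace :
    IsClosed (centeredSystemSubspace β M N : Set (L2 β M N)) :=
  isClosed_fixedSubspace.inter (Submodule.isClosed_orthogonal _)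

theorem equilibriumSubspace_le_systemSubspace :
    equilibriumSubspace β M N ≤ systemSubspace β M N := fun _ hf =>
  mem_fixedSubspace.2 fun j => mem_fixedSubspace.1 hf (Sum.inr j)

theorem toLp_mem_systemSubspace {h : (Fin M → ℝ) → ℝ}
    (hh : MemLp (fun x : Velocities M N => h fun i => x (Sum.inl i)) 2 (maxwellian β M N)) :
    hh.toLp _ ∈ systemSubspace β M N :=
  mem_fixedSubspace.2 fun j =>
    averageOp_toLp_of_invariant _ hh fun x u => by simp [refreshMap]

theorem const_mem_equilibriumSubspace (c : ℝ) :
    Lp.const 2 (maxwellian β M N) c ∈ equilibriumSubspace β M N :=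
  mem_fixedSubspace.2 fun a =>
    averageOp_toLp_of_invariant (measurePreserving_refreshMap β a) (memLp_const c) fun _ _ => rfl

theorem sub_starProjection_mem_centeredSystemSubspace {f : L2 β M N}
    (hf : f ∈ systemSubspace β M N) :
    f - (equilibriumSubspace β M N).starProjection f ∈ centeredSystemSubspace β M N :=
  ⟨sub_mem hf (equilibriumSubspace_le_systemSubspace (Submodule.starProjection_apply_mem _ f)),
    Submodule.sub_starProjection_mem_orthogonal f⟩

theorem norm_sub_starProjection_le_norm_sub_const (f : L2 β M N) (c : ℝ) :
    ‖f - (equilibriumSubspace β M N).starProjection f‖ ≤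
      ‖f - Lp.const 2 (maxwellian β M N) c‖ := by
  rw [Submodule.starProjection_minimal]
  exact ciInf_le ⟨0, by rintro _ ⟨x, rfl⟩; exact norm_nonneg _⟩
    (⟨_, const_mem_equilibriumSubspace c⟩ : equilibriumSubspace β M N)

theorem norm_sq_le_sum_norm_sub_refreshOp_sq {f : L2 β M N}
    (hf : f ∈ centeredSystemSubspace β M N) :
    ‖f‖ ^ 2 ≤ ∑ i : Fin M, ‖f - refreshOp β (Sum.inl i) f‖ ^ 2 := by
  have h := norm_sq_le_sum_norm_sub_sq (isSymmetricProjection_refreshOp β)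
    (commute_refreshOp_refreshOp β) hf.2
  simpa [Fintype.sum_sum_type, mem_fixedSubspace.1 hf.1] using h

theorem norm_sum_thermostatOp_sub_interactionOp_le (i : Fin M) {f : L2 β M N}
    (hf : f ∈ systemSubspace β M N) :
    ‖∑ j : Fin N, (thermostatOp β N i f - interactionOp β i j f)‖ ≤ Real.sqrt N / 2 * ‖f‖ := by
  have hfix := mem_fixedSubspace.1 hf
  -- The operators `R_{i,j}` act on `f` like independent copies with conditional mean `T_i f`.
  have horth : Pairwise fun j k => inner ℝ (thermostatOp β N i f - interactionOp β i j f)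
      (thermostatOp β N i f - interactionOp β i k f) = 0 := by
    intro j k hjk
    rw [inner_sub_left, inner_sub_right, inner_sub_right, real_inner_self_eq_norm_sq,
      inner_interactionOp_interactionOp i hjk (hfix j) (hfix k), real_inner_comm,
      inner_interactionOp_thermostatOp i (hfix j), inner_interactionOp_thermostatOp i (hfix k)]
    ring
  have hterm : ∀ j : Fin N, ‖thermostatOp β N i f - interactionOp β i j f‖ ^ 2 ≤
      1 / 4 * ‖f‖ ^ 2 := fun j => by
    have hR : inner ℝ (interactionOp β i j f) f = ‖interactionOp β i j f‖ ^ 2 :=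
      inner_apply_self_eq_norm_sq (isSymmetricProjection_collisionOp β _) f
    have hquarter := inner_sub_norm_sq_le (thermostatOp β N i f) f
    rw [inner_thermostatOp i (hfix j) (hfix j), hR] at hquarter
    rw [norm_sub_sq_real, real_inner_comm, inner_interactionOp_thermostatOp i (hfix j)]
    linarith
  refine le_of_sq_le_sq ?_ (by positivity)
  rw [norm_sum_sq_of_pairwise_inner_eq_zero _ horth, mul_pow, div_pow, Real.sq_sqrt (by positivity)]
  refine (Finset.sum_le_card_nsmul _ _ _ fun j _ => hterm j).trans_eq ?_
  rw [Finset.card_univ, Fintype.card_fin, nsmul_eq_mul]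
  ring

end System

/-! ### Estimates for the generators -/

section Estimates

variable {β : ℝ≥0} {M N : ℕ} {lamS lamR mu : ℝ}

theorem generatorI_eq_jumpGenerator : generatorI β M N mu =
    jumpGenerator (mu / N) fun p : Fin M × Fin N => interactionOp β p.1 p.2 := by
  rw [jumpGenerator, Fintype.sum_prod_type, generatorI]

theorem generatorT_eq_jumpGenerator : generatorT β M N mu = jumpGenerator mu (thermostatOp β N) :=
  rfl

theorem inner_generatorS_self_nonpos (hlamS : 0 ≤ lamS) (f : L2 β M N) :
    inner ℝ (generatorS β M N lamS f) f ≤ 0 :=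
  inner_jumpGenerator_pairs_nonpos (fun _ => isSymmetricProjection_collisionOp β _) hlamS f

theorem inner_generatorFR_self_nonpos (hlamS : 0 ≤ lamS) (hlamR : 0 ≤ lamR) (hmu : 0 ≤ mu)
    (f : L2 β M N) : inner ℝ (generatorFR β M N lamS lamR mu f) f ≤ 0 := by
  have hR : inner ℝ (generatorR β M N lamR f) f ≤ 0 :=
    inner_jumpGenerator_pairs_nonpos (fun _ => isSymmetricProjection_collisionOp β _) hlamR f
  have hI : inner ℝ (generatorI β M N mu f) f ≤ 0 := by
    rw [generatorI_eq_jumpGenerator]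
    exact inner_jumpGenerator_self_nonpos (fun _ => isSymmetricProjection_collisionOp β _)
      (div_nonneg hmu N.cast_nonneg) f
  rw [generatorFR, add_apply, add_apply, inner_add_left, inner_add_left]
  linarith [inner_generatorS_self_nonpos hlamS f]

theorem generatorR_apply_eq_zero {f : L2 β M N} (hf : f ∈ systemSubspace β M N) :
    generatorR β M N lamR f = 0 :=
  jumpGenerator_apply_eq_zero <| mem_fixedSubspace.2 fun _ =>
    collisionOp_apply_of_refreshOp_eq β _ (mem_fixedSubspace.1 hf _) (mem_fixedSubspace.1 hf _)

theorem generatorS_apply_eq_zero {f : L2 β M N} (hf : f ∈ equilibriumSubspace β M N) :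
    generatorS β M N lamS f = 0 :=
  jumpGenerator_apply_eq_zero <| mem_fixedSubspace.2 fun _ =>
    collisionOp_apply_of_refreshOp_eq β _ (mem_fixedSubspace.1 hf _) (mem_fixedSubspace.1 hf _)

theorem generatorI_apply_eq_zero {f : L2 β M N} (hf : f ∈ equilibriumSubspace β M N) :
    generatorI β M N mu f = 0 := by
  rw [generatorI_eq_jumpGenerator]
  exact jumpGenerator_apply_eq_zero <| mem_fixedSubspace.2 fun _ =>
    collisionOp_apply_of_refreshOp_eq β _ (mem_fixedSubspace.1 hf _) (mem_fixedSubspace.1 hf _)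

theorem generatorT_apply_eq_zero {f : L2 β M N} (hf : f ∈ equilibriumSubspace β M N) :
    generatorT β M N mu f = 0 :=
  jumpGenerator_apply_eq_zero <| mem_fixedSubspace.2 fun i => by
    simpa only [mul_apply_eq_comp, mem_fixedSubspace.1 hf (Sum.inl i)] using
      DFunLike.congr_fun (thermostatOp_mul_refreshOp_inl β i) f

theorem generatorFR_apply_eq_zero {f : L2 β M N} (hf : f ∈ equilibriumSubspace β M N) :
    generatorFR β M N lamS lamR mu f = 0 := by
  rw [generatorFR, add_apply, add_apply, generatorS_apply_eq_zero hf,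
    generatorR_apply_eq_zero (equilibriumSubspace_le_systemSubspace hf),
    generatorI_apply_eq_zero hf, add_zero, add_zero]

theorem generatorTh_apply_eq_zero {f : L2 β M N} (hf : f ∈ equilibriumSubspace β M N) :
    generatorTh β M N lamS lamR mu f = 0 := by
  rw [generatorTh, add_apply, add_apply, generatorS_apply_eq_zero hf,
    generatorR_apply_eq_zero (equilibriumSubspace_le_systemSubspace hf),
    generatorT_apply_eq_zero hf, add_zero, add_zero]

theorem generatorTh_apply_of_mem {f : L2 β M N} (hf : f ∈ systemSubspace β M N) :
    generatorTh β M N lamS lamR mu f = generatorS β M N lamS f + generatorT β M N mu f := by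
  rw [generatorTh, add_apply, add_apply, generatorR_apply_eq_zero hf, add_zero]

theorem generatorTh_apply_mem_systemSubspace {f : L2 β M N} (hf : f ∈ systemSubspace β M N) :
    generatorTh β M N lamS lamR mu f ∈ systemSubspace β M N := by
  rw [generatorTh_apply_of_mem hf]
  refine add_mem (apply_mem_fixedSubspace (fun j => ?_) hf)
    (apply_mem_fixedSubspace (fun j => ?_) hf)
  · exact commute_jumpGenerator fun p =>
      commute_refreshOp_collisionOp β _ Sum.inr_ne_inl Sum.inr_ne_inl
  · exact commute_jumpGenerator fun i => commute_refreshOp_thermostatOp β Sum.inr_ne_inl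

theorem inner_generatorTh_left (hN : 0 < N) {f g : L2 β M N} (hf : f ∈ systemSubspace β M N)
    (hg : g ∈ systemSubspace β M N) :
    inner ℝ (generatorTh β M N lamS lamR mu f) g =
      inner ℝ f (generatorTh β M N lamS lamR mu g) := by
  have hS : inner ℝ (generatorS β M N lamS f) g = inner ℝ f (generatorS β M N lamS g) :=
    inner_jumpGenerator_left fun p => inner_collisionOp_left β _ f g
  have hT : inner ℝ (generatorT β M N mu f) g = inner ℝ f (generatorT β M N mu g) :=
    inner_jumpGenerator_left fun i => inner_thermostatOp_left i
      (mem_fixedSubspace.1 hf ⟨0, hN⟩) (mem_fixedSubspace.1 hg ⟨0, hN⟩)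
  rw [generatorTh_apply_of_mem hf, generatorTh_apply_of_mem hg, inner_add_left, inner_add_right,
    hS, hT]

theorem generatorTh_apply_mem_centeredSystemSubspace (hN : 0 < N) {f : L2 β M N}
    (hf : f ∈ centeredSystemSubspace β M N) :
    generatorTh β M N lamS lamR mu f ∈ centeredSystemSubspace β M N := by
  refine ⟨generatorTh_apply_mem_systemSubspace hf.1, ?_⟩
  refine (Submodule.mem_orthogonal _ _).2 fun g hg => ?_
  rw [← inner_generatorTh_left hN (equilibriumSubspace_le_systemSubspace hg) hf.1,
    generatorTh_apply_eq_zero hg, inner_zero_left]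

theorem inner_generatorT_self_le (hN : 0 < N) (hmu : 0 ≤ mu) {f : L2 β M N}
    (hf : f ∈ centeredSystemSubspace β M N) :
    inner ℝ (generatorT β M N mu f) f ≤ -(mu / 2) * ‖f‖ ^ 2 := by
  have hfix : refreshOp β (Sum.inr ⟨0, hN⟩) f = f := mem_fixedSubspace.1 hf.1 _
  rw [generatorT_eq_jumpGenerator, jumpGenerator_apply, real_inner_smul_left, sum_inner]
  calc mu * ∑ i, inner ℝ (thermostatOp β N i f - f) f
      ≤ mu * ∑ i : Fin M, -(1 / 2) * ‖f - refreshOp β (Sum.inl i) f‖ ^ 2 := by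
        gcongr with i
        exact inner_thermostatOp_sub_self_le i hfix
    _ = -(mu / 2) * ∑ i : Fin M, ‖f - refreshOp β (Sum.inl i) f‖ ^ 2 := by
        rw [← Finset.mul_sum]
        ring
    _ ≤ -(mu / 2) * ‖f‖ ^ 2 :=
        mul_le_mul_of_nonpos_left (norm_sq_le_sum_norm_sub_refreshOp_sq hf) (by linarith)

theorem inner_generatorTh_self_le (hN : 0 < N) (hlamS : 0 ≤ lamS) (hmu : 0 ≤ mu) {f : L2 β M N}
    (hf : f ∈ centeredSystemSubspace β M N) :
    inner ℝ (generatorTh β M N lamS lamR mu f) f ≤ -(mu / 2) * ‖f‖ ^ 2 := by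
  rw [generatorTh_apply_of_mem hf.1, inner_add_left]
  linarith [inner_generatorS_self_nonpos hlamS f, inner_generatorT_self_le hN hmu hf]

theorem generatorTh_sub_generatorFR_apply (hN : 0 < N) (f : L2 β M N) :
    (generatorTh β M N lamS lamR mu - generatorFR β M N lamS lamR mu) f =
      (mu / N) • ∑ i, ∑ j, (thermostatOp β N i f - interactionOp β i j f) := by
  have hN' : (N : ℝ) ≠ 0 := by exact_mod_cast hN.ne'
  have hsum : ∀ i : Fin M, ∑ j : Fin N, (thermostatOp β N i f - interactionOp β i j f) =
      (N : ℝ) • (thermostatOp β N i f - f) - ∑ j : Fin N, (interactionOp β i j f - f) := by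
    intro i
    simp only [Finset.sum_sub_distrib, Finset.sum_const, Finset.card_univ, Fintype.card_fin,
      ← Nat.cast_smul_eq_nsmul ℝ, smul_sub]
    abel
  simp only [hsum]
  rw [Finset.sum_sub_distrib, ← Finset.smul_sum, smul_sub, smul_smul, div_mul_cancel₀ _ hN',
    generatorTh, generatorFR, add_sub_add_left_eq_sub, sub_apply, generatorT_eq_jumpGenerator,
    generatorI_eq_jumpGenerator, jumpGenerator_apply, jumpGenerator_apply, Fintype.sum_prod_type]

theorem norm_generatorTh_sub_generatorFR_apply_le (hN : 0 < N) (hmu : 0 ≤ mu) {f : L2 β M N}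
    (hf : f ∈ systemSubspace β M N) :
    ‖(generatorTh β M N lamS lamR mu - generatorFR β M N lamS lamR mu) f‖ ≤
      M / Real.sqrt N * (mu / 2) * ‖f‖ := by
  have hsqrt : Real.sqrt N ≠ 0 := (Real.sqrt_pos.2 (by exact_mod_cast hN)).ne'
  rw [generatorTh_sub_generatorFR_apply hN, norm_smul, Real.norm_of_nonneg (by positivity)]
  calc mu / N * ‖∑ i, ∑ j, (thermostatOp β N i f - interactionOp β i j f)‖
      ≤ mu / N * ∑ _i : Fin M, Real.sqrt N / 2 * ‖f‖ := by
        gcongr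
        exact norm_sum_le_of_le _ fun i _ => norm_sum_thermostatOp_sub_interactionOp_le i hf
    _ = mu / (Real.sqrt N * Real.sqrt N) * (M * (Real.sqrt N / 2 * ‖f‖)) := by
        rw [Finset.sum_const, Finset.card_univ, Fintype.card_fin, nsmul_eq_mul,
          Real.mul_self_sqrt N.cast_nonneg]
    _ = M / Real.sqrt N * (mu / 2) * ‖f‖ := by field_simp

end Estimates

end KacReservoir

end

theorem mainTheorem1 (β : ℝ≥0) (hβ : 0 < β) (M N : ℕ) (hN : 0 < N)
    (lamS lamR mu : ℝ) (hlamS : 0 ≤ lamS) (hlamR : 0 ≤ lamR) (hmu : 0 ≤ mu)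
    (h₀ : (Fin M → ℝ) → ℝ)
    (hh₀ : MemLp (fun x : KacReservoir.Velocities M N => h₀ (fun i => x (Sum.inl i))) 2 (KacReservoir.maxwellian β M N))
    (t : ℝ) (ht : 0 < t) :
    ‖NormedSpace.exp (t • KacReservoir.generatorTh β M N lamS lamR mu) (hh₀.toLp _) -
        NormedSpace.exp (t • KacReservoir.generatorFR β M N lamS lamR mu) (hh₀.toLp _)‖ ≤
      (M : ℝ) / Real.sqrt N * (1 - Real.exp (-(mu / 2) * t)) *
        ‖hh₀.toLp _ - Lp.const 2 (KacReservoir.maxwellian β M N) (1 : ℝ)‖ := by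
  open KacReservoir in
  set h : L2 β M N := hh₀.toLp _
  set A := generatorTh β M N lamS lamR mu
  set B := generatorFR β M N lamS lamR mu
  set e := (equilibriumSubspace β M N).starProjection h
  have he : e ∈ equilibriumSubspace β M N := Submodule.starProjection_apply_mem _ h
  have hexp : 0 ≤ 1 - Real.exp (-(mu / 2) * t) := by
    rw [sub_nonneg, Real.exp_le_one_iff]
    nlinarith
  calc ‖NormedSpace.exp (t • A) h - NormedSpace.exp (t • B) h‖
      = ‖NormedSpace.exp (t • A) (h - e) - NormedSpace.exp (t • B) (h - e)‖ := by
        rw [map_sub, map_sub, exp_smul_apply_of_apply_eq_zero (generatorTh_apply_eq_zero he),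
          exp_smul_apply_of_apply_eq_zero (generatorFR_apply_eq_zero he), sub_sub_sub_cancel_right]
    _ ≤ M / Real.sqrt N * (1 - Real.exp (-(mu / 2) * t)) * ‖h - e‖ :=
        norm_exp_smul_sub_exp_smul_le_of_inner_le isClosed_centeredSystemSubspace
          (fun _ => generatorTh_apply_mem_centeredSystemSubspace hN) (by positivity)
          (fun _ => inner_generatorTh_self_le hN hlamS hmu)
          (inner_generatorFR_self_nonpos hlamS hlamR hmu)
          (fun _ hf => norm_generatorTh_sub_generatorFR_apply_le hN hmu hf.1)
          (sub_starProjection_mem_centeredSystemSubspace (toLp_mem_systemSubspace hh₀)) ht.le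
    _ ≤ _ := by
        gcongr
        exact norm_sub_starProjection_le_norm_sub_const h 1
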